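/- Let $\mathcal D$ be a weighted oriented graph on a finite vertex set $V$: a directed graph without loops in which every two vertices are joined by at most one directed edge, together with a weight function $\omega\colon V\to\mathbb Z_{>0}$. Assume that $\omega(v)=1$ for every source $v$, that is, every non-isolated vertex $v$ all of whose edges are outgoing. Let $G$ be the underlying simple graph of $\mathcal D$, let $K$ be a field, let $R=K[x_v \mid v\in V]$, and let $$I(\mathcal D)=\bigl(x_u x_v^{\omega(v)} \mid (u,v)\in E(\mathcal D)\bigr)\subseteq R$$ be the edge ideal of $\mathcal D$. For an ideal $I\subseteq R$ let $I^{(t)}=\bigcap_{\mathfrak p\in\operatorname{Min}(I)}(I^tR_{\mathfrak p}\cap R)$ be its $t$-th symbolic power, where $\operatorname{Min}(I)$ is the set of minimal primes of $I$. Then for every integer $t\ge 2$ the following conditions are equivalent: (1) $I(\mathcal D)^t=I(\mathcal D)^{(t)}$; (2) every vertex $v$ with $\omega(v)\ge 2$ is a sink (it has no outgoing edge), and $G$ contains no cycle (induced or not) of length $2s-1$ for any integer $s$ with $2\le s\le t$. -/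

import Mathlib

/-- A vertex-weighted oriented graph on the vertex set `V`: a directed graph that never contains
both `(u, v)` and `(v, u)` (in particular it has no loops), with a positive integer weight on every
vertex. -/
structure WeightedOrientedGraph (V : Type*) where
  /-- The directed graph; `toDigraph.Adj u v` says that `(u, v)` is an edge, directed from `u` to `v`. -/
  toDigraph : Digraph V
  asymm : ∀ u v, toDigraph.Adj u v → ¬ toDigraph.Adj v u
  /-- The weight function. -/
  weight : V → ℕ
  weight_pos : ∀ v, 0 < weight v

namespace WeightedOrientedGraph

/-- The underlying simple graph, obtained by forgetting the directions of the edges. -/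
def underlying {V : Type*} (D : WeightedOrientedGraph V) : SimpleGraph V :=
  D.toDigraph.toSimpleGraphInclusive

/-- A sink is a vertex all of whose edges are incoming. -/
def IsSink {V : Type*} (D : WeightedOrientedGraph V) (v : V) : Prop :=
  ∀ u, ¬ D.toDigraph.Adj v u

/-- A source is a vertex that has edges, all of them outgoing. (An isolated vertex is not
counted as a source, so that it may carry an arbitrary weight.) -/
def IsSource {V : Type*} (D : WeightedOrientedGraph V) (v : V) : Prop :=
  (∃ u, D.toDigraph.Adj v u) ∧ ∀ u, ¬ D.toDigraph.Adj u v

/-- The set `V⁺(D)` of vertices of weight at least two. -/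
def heavyVertices {V : Type*} (D : WeightedOrientedGraph V) : Set V :=
  {v | 2 ≤ D.weight v}

/-- The edge ideal `(x_i x_j ^ ω(j) | (i, j) ∈ E(D))` in the polynomial ring `K[x_v | v ∈ V]`. -/
noncomputable def edgeIdeal {V : Type*} (K : Type*) [Field K] (D : WeightedOrientedGraph V) :
    Ideal (MvPolynomial V K) :=
  Ideal.span {f | ∃ i j, D.toDigraph.Adj i j ∧
    f = MvPolynomial.X i * MvPolynomial.X j ^ D.weight j}

end WeightedOrientedGraph

/-- The `t`-th symbolic power `⋂_{p ∈ Min(I)} (I ^ t R_p ∩ R)` of an ideal `I`. -/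
noncomputable def idealSymbolicPower {R : Type*} [CommRing R] (I : Ideal R) (t : ℕ) : Ideal R :=
  ⨅ (p : Ideal R) (hp : p ∈ I.minimalPrimes),
    haveI : p.IsPrime := hp.1.1
    ((I ^ t).map (algebraMap R (Localization.AtPrime p))).comap
      (algebraMap R (Localization.AtPrime p))

/-- The graph `G` contains a cycle of length `m` (as a subgraph, not necessarily induced). -/
def SimpleGraph.ContainsCycleOfLength {V : Type*} (G : SimpleGraph V) (m : ℕ) : Prop :=
  ∃ (v : V) (c : G.Walk v v), c.IsCycle ∧ c.length = m

/-!
The symbolic power is compared with the ordinary power one monomial at a time, through superadditive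
functions `Φ` on exponents: if `Φ ≥ N` on the generators of `I`, then `Φ ≥ t * N` on every monomial
of `I ^ t` (`MvPolynomial.le_of_mem_support_of_mem_span_pow`). The minimal primes of `I(D)` are
generated by the variables of the minimal vertex covers of `G`.

If all heavy vertices are sinks, every edge `uv` of `G` gives the generator
`x_u ^ ω(u) * x_v ^ ω(v)`, because the tail of an edge has weight one. Put `b v = ⌊a v / ω v⌋`. If
`x ^ a` occurs in an element of the symbolic power, then `∑ v ∈ C, b v ≥ t` for every vertex cover
`C` (`le_level_of_mem_idealSymbolicPower`), and `x ^ a` lies in `I ^ t` as soon as the blow-up of `G`,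
with `b v` copies of `v`, contains `t` disjoint edges (`monomial_mem_edgeIdeal_pow`). These exist when
`G` has no odd cycle of length less than `2 * t + 1` (`SimpleGraph.exists_blowUp_matching`): either
the support of `b` contains an odd cycle, which is so long that it carries `t` disjoint edges, or the
graph induced on the support is bipartite and König's theorem applies.

Conversely, a closed walk of length `2 * s - 1` meets every vertex cover at least `s` times, so the
product of the `x_v ^ ω(v)` along it, times `t - s` edges, lies in the symbolic power. Its level is
`2 * t - 1`, whereas elements of `I ^ t` have level at least `2 * t` (`lt_of_odd_closed_walk`). A heavy
vertex `v` that is not a sink is not a source either, so it lies on a path `u → v → z`. Then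
`x_u * x_v ^ ω(v) * x_z ^ ω(z)` lies in the second symbolic power, since `x_v` itself is locally in `I`
whenever `x_z` becomes a unit, and `ω(v) ≥ 2`. Multiplied by a power of the edge `uv` it stays outside
`I ^ t`, which a suitable linear functional detects (`isSink_of_pow_eq_idealSymbolicPower`).
-/

/-! ### Odd cycles, vertex covers and matchings -/

namespace SimpleGraph

variable {V : Type*} {G : SimpleGraph V}

/-- Without odd cycles, shortening a walk to a path preserves the parity of its length, since only
closed walks of even length are removed. -/
theorem Walk.exists_isPath_odd_length_iff
    (hG : ∀ (x : V) (c : G.Walk x x), c.IsCycle → ¬ Odd c.length) {u v : V} (p : G.Walk u v) :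
    ∃ q : G.Walk u v, q.IsPath ∧ (Odd q.length ↔ Odd p.length) := by
  classical
  induction p with
  | nil => exact ⟨.nil, .nil, Iff.rfl⟩
  | @cons u u' v h p ih =>
    obtain ⟨q, hq, hpar⟩ := ih
    by_cases hu : u ∈ q.support
    · have hlen : (q.takeUntil u hu).length + (q.dropUntil u hu).length = q.length := by
        rw [← Walk.length_append, q.take_spec hu]
      have heven : ¬ Odd (Walk.cons h (q.takeUntil u hu)).length := by
        intro ho
        refine hG u _ (Walk.isCycle_iff_isPath_tail_and_le_length.2
          ⟨by simpa using hq.takeUntil hu, ?_⟩) ho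
        have hpos : (q.takeUntil u hu).length ≠ 0 := fun h0 ↦
          h.ne (Walk.eq_of_length_eq_zero h0).symm
        rw [Walk.length_cons] at ho ⊢
        obtain ⟨k, hk⟩ := ho
        omega
      refine ⟨q.dropUntil u hu, hq.dropUntil hu, ?_⟩
      simp only [Walk.length_cons, Nat.odd_iff] at *
      omega
    · exact ⟨.cons h q, hq.cons hu, by simp [Nat.odd_add_one, hpar]⟩

/-- Only cycles are assumed not to be odd; Mathlib's criterion asks for all closed walks. -/
theorem colorable_two_of_forall_isCycle_not_odd
    (hG : ∀ (x : V) (c : G.Walk x x), c.IsCycle → ¬ Odd c.length) : G.Colorable 2 := by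
  rw [two_colorable_iff_forall_loop_even]
  intro u w
  obtain ⟨q, hq, hpar⟩ := Walk.exists_isPath_odd_length_iff hG w
  rw [← Nat.not_odd_iff_even, ← hpar, (Walk.isPath_iff_nil.1 hq).eq_nil]
  simp

open Classical in
/-- Each step of a walk meets a vertex cover; the two end points are counted once, all other
visits twice. -/
theorem IsVertexCover.length_add_le {C : Set V} (hC : G.IsVertexCover C) {u v : V}
    (p : G.Walk u v) :
    p.length + (if v ∈ C then 1 else 0) ≤
      2 * p.support.tail.countP (· ∈ C) + (if u ∈ C then 1 else 0) := by
  induction p with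
  | nil => simp
  | @cons u u' v h p ih =>
    have hcov := hC h
    have hcount : p.support.countP (· ∈ C) =
        p.support.tail.countP (· ∈ C) + (if u' ∈ C then 1 else 0) := by
      conv_lhs => rw [← Walk.cons_tail_support p, List.countP_cons]
      simp
    simp only [Walk.length_cons, Walk.support_cons, List.tail_cons, hcount]
    split_ifs at * <;> first | omega | tauto

open Classical in
theorem IsVertexCover.length_le {C : Set V} (hC : G.IsVertexCover C) {u : V} (p : G.Walk u u) :
    p.length ≤ 2 * p.support.tail.countP (· ∈ C) := by
  have := hC.length_add_le p
  omega

open Classical in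
/-- The defect form of Hall's theorem: after adding `#α - t` new partners common to all elements of
`α`, Hall's condition holds, and at most `#α - t` elements are matched to a new partner. -/
theorem exists_matching_of_card_le {α β : Type*} [Fintype α] [Fintype β] (r : α → β → Prop)
    (t : ℕ)
    (hr : ∀ S : Finset α, t + S.card ≤
      (Finset.univ.filter fun y ↦ ∃ x ∈ S, r x y).card + Fintype.card α) :
    ∃ (g : Fin t → α) (h : Fin t → β), g.Injective ∧ h.Injective ∧ ∀ i, r (g i) (h i) := by
  have ht : t ≤ Fintype.card α := by simpa using hr ∅
  -- The summand `Fin (#α - t)` consists of partners admissible for every `x`.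
  let r' : α → β ⊕ Fin (Fintype.card α - t) → Prop := fun x y ↦ ∀ z, y = Sum.inl z → r x z
  obtain ⟨f, hf, hrf⟩ := (Fintype.all_card_le_filter_rel_iff_exists_injective r').1 (by
    intro S
    rcases S.eq_empty_or_nonempty with rfl | ⟨x₀, hx₀⟩
    · simp
    have hsub : (Finset.univ.filter fun y ↦ ∃ x ∈ S, r x y).disjSum Finset.univ ⊆
        Finset.univ.filter fun y ↦ ∃ x ∈ S, r' x y := by
      intro y hy
      rcases Finset.mem_disjSum.1 hy with ⟨z, hz, rfl⟩ | ⟨z, -, rfl⟩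
      · obtain ⟨x, hx, hxz⟩ := (Finset.mem_filter.1 hz).2
        exact Finset.mem_filter.2 ⟨Finset.mem_univ _, x, hx, fun z' hz' ↦ by
          cases hz'; exact hxz⟩
      · exact Finset.mem_filter.2 ⟨Finset.mem_univ _, x₀, hx₀, fun z' hz' ↦ by cases hz'⟩
    have hcard := Finset.card_le_card hsub
    rw [Finset.card_disjSum, Finset.card_univ, Fintype.card_fin] at hcard
    have := hr S
    omega)
  have hL : t ≤ Fintype.card {x // (f x).isLeft} := by
    have hR : Fintype.card {x // ¬ (f x).isLeft} ≤ Fintype.card α - t := by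
      refine (Fintype.card_le_of_injective
        (fun x : {x // ¬ (f x).isLeft} ↦ (f x.1).getRight (by simpa using x.2)) ?_).trans_eq
          (Fintype.card_fin _)
      intro x y hxy
      apply Subtype.ext
      apply hf
      rw [← Sum.inr_getRight (f x.1) (by simpa using x.2),
        ← Sum.inr_getRight (f y.1) (by simpa using y.2)]
      exact congrArg _ hxy
    have := Fintype.card_subtype_compl (fun x ↦ ((f x).isLeft : Prop))
    omega
  obtain ⟨e⟩ := Function.Embedding.nonempty_of_card_le
    (α := Fin t) (β := {x // (f x).isLeft}) (by simpa using hL)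
  refine ⟨fun i ↦ (e i).1, fun i ↦ (f (e i).1).getLeft (e i).2,
    Subtype.val_injective.comp e.injective, ?_, fun i ↦ hrf _ _ (by simp)⟩
  intro i j hij
  apply e.injective
  apply Subtype.ext
  apply hf
  rw [← Sum.inl_getLeft (f (e i).1) (e i).2, ← Sum.inl_getLeft (f (e j).1) (e j).2]
  exact congrArg _ hij

open Classical in
/-- König's theorem for the blow-up of a graph with `b v` copies of each vertex `v`. The colouring
has to be proper only on the vertices with `0 < b v`, the others having no copies. -/
theorem exists_blowUp_matching_of_coloring [Fintype V] (b : V → ℕ) (t : ℕ) (col : V → Bool)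
    (hcol : ∀ u v, 0 < b u → 0 < b v → G.Adj u v → col u ≠ col v)
    (hcover : ∀ C : Finset V, G.IsVertexCover C → t ≤ ∑ v ∈ C, b v) :
    ∃ g h : Fin t → Σ v, Fin (b v), (Sum.elim g h).Injective ∧ ∀ i, G.Adj (g i).1 (h i).1 := by
  obtain ⟨g, h, hg, hh, hgh⟩ := exists_matching_of_card_le
    (α := {x : Σ v, Fin (b v) // col x.1 = true})
    (β := {x : Σ v, Fin (b v) // col x.1 = false}) (fun x y ↦ G.Adj x.1.1 y.1.1) t (by
    intro S
    set N := Finset.univ.filter fun y : {x : Σ v, Fin (b v) // col x.1 = false} ↦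
      ∃ x ∈ S, G.Adj x.1.1 y.1.1 with hN
    let Z : Finset (Σ v, Fin (b v)) :=
      Sᶜ.map (Function.Embedding.subtype _) ∪ N.map (Function.Embedding.subtype _)
    have hZ : Z.card ≤ Fintype.card {x : Σ v, Fin (b v) // col x.1 = true} - S.card + N.card := by
      refine (Finset.card_union_le _ _).trans ?_
      rw [Finset.card_map, Finset.card_map, Finset.card_compl]
    -- `Z` covers the blow-up; a vertex is put into `C` when all its copies lie in `Z`.
    let C : Finset V := Finset.univ.filter fun v ↦ ∀ i : Fin (b v), (⟨v, i⟩ : Σ v, Fin (b v)) ∈ Z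
    have hC : ∑ v ∈ C, b v ≤ Z.card := by
      have : (C.sigma fun v ↦ (Finset.univ : Finset (Fin (b v)))).card = ∑ v ∈ C, b v := by
        simp
      rw [← this]
      refine Finset.card_le_card fun x hx ↦ ?_
      exact (Finset.mem_filter.1 (Finset.mem_sigma.1 hx).1).2 x.2
    have key : ∀ u v, G.Adj u v → col u = true → col v = false → u ∉ C → v ∈ C := by
      intro u v huv hu hv huC
      simp only [C, Finset.mem_filter, Finset.mem_univ, true_and, not_forall] at huC ⊢
      obtain ⟨i, hi⟩ := huC
      have hiS : (⟨⟨u, i⟩, hu⟩ : {x : Σ v, Fin (b v) // col x.1 = true}) ∈ S := by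
        by_contra hcon
        exact hi (Finset.mem_union_left _ (Finset.mem_map.2
          ⟨_, Finset.mem_compl.2 hcon, rfl⟩))
      intro j
      refine Finset.mem_union_right _ (Finset.mem_map.2 ⟨⟨⟨v, j⟩, hv⟩, ?_, rfl⟩)
      exact Finset.mem_filter.2 ⟨Finset.mem_univ _, _, hiS, huv⟩
    have hzero : ∀ v, ¬ 0 < b v → v ∈ C := fun v hv ↦
      Finset.mem_filter.2 ⟨Finset.mem_univ _, fun i ↦ absurd i.pos hv⟩
    have hCcov : G.IsVertexCover C := by
      intro u v huv
      by_contra! hcon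
      have hne := hcol u v (not_not.1 fun h ↦ hcon.1 (hzero u h))
        (not_not.1 fun h ↦ hcon.2 (hzero v h)) huv
      cases hu : col u
      · exact hcon.1 (key v u huv.symm (by cases hv : col v <;> simp_all) hu hcon.2)
      · exact hcon.2 (key u v huv hu (by cases hv : col v <;> simp_all) hcon.1)
    have h1 := hcover C hCcov
    have h2 := Finset.card_le_univ S
    omega)
  refine ⟨fun i ↦ (g i).1, fun i ↦ (h i).1, ?_, hgh⟩
  refine (Subtype.val_injective.comp hg).sumElim (Subtype.val_injective.comp hh) ?_
  intro i j hij
  have h1 := (g i).2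
  have h2 := (h j).2
  rw [show (g i).1 = (h j).1 from hij, h2] at h1
  cases h1

/-- Every other edge along a cycle of length at least `2 * t + 1`, with one copy of each vertex. -/
theorem exists_blowUp_matching_of_isCycle (b : V → ℕ) (t : ℕ) {x : V} {c : G.Walk x x}
    (hc : c.IsCycle) (hlen : 2 * t + 1 ≤ c.length) (hpos : ∀ v ∈ c.support, 0 < b v) :
    ∃ g h : Fin t → Σ v, Fin (b v), (Sum.elim g h).Injective ∧ ∀ i, G.Adj (g i).1 (h i).1 := by
  have hb : ∀ i, 0 < b (c.getVert i) := fun i ↦ hpos _ (c.getVert_mem_support i)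
  let q : ℕ → Σ v, Fin (b v) := fun i ↦ ⟨c.getVert i, ⟨0, hb i⟩⟩
  have hq : ∀ i j, i < c.length → j < c.length → q i = q j → i = j := by
    intro i j hi hj hij
    exact hc.getVert_injOn' (by simp; omega) (by simp; omega) (congrArg Sigma.fst hij)
  refine ⟨fun i ↦ q (2 * i), fun i ↦ q (2 * i + 1), ?_, fun i ↦
    c.adj_getVert_succ (by omega)⟩
  rintro (i | i) (j | j) hij <;>
    have := hq _ _ (by omega) (by omega) hij
  · exact congrArg _ (Fin.ext (by omega))
  · omega
  · omega
  · exact congrArg _ (Fin.ext (by omega))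

/-- If every vertex cover has `b`-weight at least `t` and all odd cycles have length at least
`2 * t + 1`, the blow-up with `b v` copies of each `v` has `t` pairwise disjoint edges. -/
theorem exists_blowUp_matching [Fintype V] (b : V → ℕ) (t : ℕ)
    (hcover : ∀ C : Finset V, G.IsVertexCover C → t ≤ ∑ v ∈ C, b v)
    (hodd : ∀ (x : V) (c : G.Walk x x), c.IsCycle → Odd c.length → 2 * t + 1 ≤ c.length) :
    ∃ g h : Fin t → Σ v, Fin (b v), (Sum.elim g h).Injective ∧ ∀ i, G.Adj (g i).1 (h i).1 := by
  classical
  let G' : SimpleGraph {v // 0 < b v} := G.induce {v | 0 < b v}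
  by_cases hG' : ∀ (x) (c : G'.Walk x x), c.IsCycle → ¬ Odd c.length
  · obtain ⟨f⟩ := colorable_two_of_forall_isCycle_not_odd hG'
    refine exists_blowUp_matching_of_coloring b t
      (fun v ↦ if hv : 0 < b v then decide (f ⟨v, hv⟩ = 0) else false) ?_ hcover
    intro u v hu hv huv heq
    have hne := f.valid (show G'.Adj ⟨u, hu⟩ ⟨v, hv⟩ from huv)
    simp only [hu, hv, dif_pos, decide_eq_decide] at heq
    omega
  · push Not at hG'
    obtain ⟨x, c, hc, ho⟩ := hG'
    let φ : G' →g G := ⟨Subtype.val, fun h ↦ h⟩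
    have hcφ : (c.map φ).IsCycle := hc.map Subtype.val_injective
    refine exists_blowUp_matching_of_isCycle b t hcφ (hodd _ _ hcφ (by simpa using ho)) ?_
    intro v hv
    rw [Walk.support_map, List.mem_map] at hv
    obtain ⟨y, -, rfl⟩ := hv
    exact y.2

end SimpleGraph

/-! ### Monomials in powers of ideals, and contractions of localizations -/

section

variable {σ K : Type*} [Field K]

/-- A superadditive function that is at least `N` on the monomials of the generators is at least
`t * N` on the monomials of the `t`-th power: the polynomials whose monomials all have value at
least `r` form an ideal, and these ideals multiply like a filtration. -/
theorem MvPolynomial.le_of_mem_support_of_mem_span_pow {S : Set (MvPolynomial σ K)}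
    {Φ : (σ →₀ ℕ) → ℕ} (hΦ : ∀ a b, Φ a + Φ b ≤ Φ (a + b)) {N : ℕ}
    (hS : ∀ f ∈ S, ∀ a ∈ f.support, N ≤ Φ a) (t : ℕ) {f : MvPolynomial σ K}
    (hf : f ∈ Ideal.span S ^ t) : ∀ a ∈ f.support, t * N ≤ Φ a := by
  classical
  have hup : ∀ r, IsUpperSet {a | r ≤ Φ a} := by
    intro r a b hab ha
    obtain ⟨c, rfl⟩ := le_iff_exists_add.1 hab
    exact le_trans (show r ≤ Φ a from ha) ((Nat.le_add_right _ _).trans (hΦ a c))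
  have hmem : ∀ r (g : MvPolynomial σ K),
      g ∈ restrictSupportIdeal K _ (hup r) ↔ ∀ a ∈ g.support, r ≤ Φ a := by
    intro r g
    exact ⟨fun h a ha ↦ h ha, fun h a ha ↦ h a ha⟩
  suffices h : Ideal.span S ^ t ≤ restrictSupportIdeal K _ (hup (t * N)) from
    (hmem _ f).1 (h hf)
  clear hf
  induction t with
  | zero => intro f _; rw [hmem]; simp
  | succ t ih =>
    rw [pow_succ, Ideal.mul_le]
    intro g hg h hh
    have hg' := (hmem _ g).1 (ih hg)
    have hh' := (hmem N h).1 (Ideal.span_le.2 (fun x hx ↦ (hmem N x).2 (hS x hx)) hh)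
    rw [hmem]
    intro a ha
    obtain ⟨c, hc, d, hd, rfl⟩ := Finset.mem_add.1 (support_mul g h ha)
    have := hΦ c d
    have := hg' c hc
    have := hh' d hd
    rw [Nat.succ_mul]
    omega

theorem mem_idealSymbolicPower_iff {R : Type*} [CommRing R] {I : Ideal R} {t : ℕ} {f : R} :
    f ∈ idealSymbolicPower I t ↔ ∀ p ∈ I.minimalPrimes, ∃ s ∉ p, s * f ∈ I ^ t := by
  unfold idealSymbolicPower
  simp only [Ideal.mem_iInf]
  refine forall₂_congr fun p hp ↦ ?_
  have : p.IsPrime := hp.1.1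
  rw [Ideal.mem_comap,
    IsLocalization.algebraMap_mem_map_algebraMap_iff p.primeCompl (Localization.AtPrime p)]
  rfl

theorem pow_le_idealSymbolicPower {R : Type*} [CommRing R] (I : Ideal R) (t : ℕ) :
    I ^ t ≤ idealSymbolicPower I t := fun f hf ↦
  mem_idealSymbolicPower_iff.2 fun p hp ↦
    ⟨1, (Ideal.ne_top_iff_one p).1 hp.1.1.ne_top, by simpa using hf⟩

/-- `f` lies in the contraction of the localization `J R_p`, stated without localizing. -/
def Ideal.LocMem {R : Type*} [CommRing R] (p J : Ideal R) (f : R) : Prop :=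
  ∃ s ∉ p, s * f ∈ J

namespace Ideal.LocMem

variable {R : Type*} [CommRing R] {p J J' : Ideal R} {f g : R}

theorem of_mem (hp : p.IsPrime) (hf : f ∈ J) : p.LocMem J f :=
  ⟨1, (Ideal.ne_top_iff_one p).1 hp.ne_top, by simpa using hf⟩

theorem mul (hp : p.IsPrime) (hf : p.LocMem J f) (hg : p.LocMem J' g) :
    p.LocMem (J * J') (f * g) := by
  obtain ⟨s, hs, hsf⟩ := hf
  obtain ⟨s', hs', hsg⟩ := hg
  refine ⟨s * s', fun h ↦ (hp.mem_or_mem h).elim hs hs', ?_⟩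
  rw [mul_mul_mul_comm]
  exact Ideal.mul_mem_mul hsf hsg

theorem mul_left (hf : p.LocMem J f) : p.LocMem J (g * f) := by
  obtain ⟨s, hs, hsf⟩ := hf
  exact ⟨s, hs, by rw [mul_left_comm]; exact J.mul_mem_left _ hsf⟩

theorem mono (hJ : J ≤ J') (hf : p.LocMem J f) : p.LocMem J' f :=
  hf.imp fun _ h ↦ ⟨h.1, hJ h.2⟩

/-- The power of `J` counts the factors that lie locally in `J`; the others may be arbitrary. -/
theorem list_prod_map (hp : p.IsPrime) {ι : Type*} (P : ι → Prop) [DecidablePred P] (φ : ι → R)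
    (h : ∀ i, P i → p.LocMem J (φ i)) (l : List ι) :
    p.LocMem (J ^ l.countP (fun i ↦ P i)) (l.map φ).prod := by
  induction l with
  | nil => exact of_mem hp (by simp)
  | cons i l ih =>
    rw [List.map_cons, List.prod_cons, List.countP_cons]
    by_cases hi : P i
    · simp only [hi, decide_true, if_true, pow_succ']
      exact (h i hi).mul hp ih
    · simp only [hi, decide_false, Bool.false_eq_true, if_false, add_zero]
      exact ih.mul_left

end Ideal.LocMem

open Classical in
/-- The substitution `x_v ↦ 0` for `v ∈ C`. -/
noncomputable def MvPolynomial.killVars (K : Type*) [Field K] (C : Set σ) :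
    MvPolynomial σ K →ₐ[K] MvPolynomial σ K :=
  aeval fun v ↦ if v ∈ C then 0 else X v

namespace MvPolynomial

variable {C : Set σ}

theorem killVars_X_of_mem {v : σ} (h : v ∈ C) : killVars K C (X v) = 0 := by
  simp [killVars, h]

theorem killVars_X_of_notMem {v : σ} (h : v ∉ C) : killVars K C (X v) = X v := by
  simp [killVars, h]

theorem X_mem_ker_killVars {v : σ} : X v ∈ RingHom.ker (killVars K C) ↔ v ∈ C := by
  by_cases h : v ∈ C <;> simp [RingHom.mem_ker, killVars, h, X_ne_zero]

/-- The kernel is the ideal generated by the variables in `C`: modulo these, the substitution is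
the identity. -/
theorem ker_killVars_le {q : Ideal (MvPolynomial σ K)} (h : ∀ v ∈ C, X v ∈ q) :
    RingHom.ker (killVars K C) ≤ q := by
  have heq : (Ideal.Quotient.mkₐ K q).comp (killVars K C) = Ideal.Quotient.mkₐ K q := by
    apply MvPolynomial.algHom_ext
    intro v
    by_cases hv : v ∈ C
    · simpa [killVars_X_of_mem hv] using
        (Ideal.Quotient.eq_zero_iff_mem.2 (h v hv)).symm
    · simp [killVars_X_of_notMem hv]
  intro f hf
  rw [← Ideal.Quotient.eq_zero_iff_mem]
  have := DFunLike.congr_fun heq f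
  simp only [AlgHom.comp_apply, (RingHom.mem_ker).1 hf, map_zero] at this
  exact this.symm

theorem exists_mem_support_of_notMem_ker_killVars {s : MvPolynomial σ K}
    (hs : s ∉ RingHom.ker (killVars K C)) : ∃ a ∈ s.support, ∀ v ∈ C, a v = 0 := by
  by_contra! hcon
  have : s ∈ Ideal.span (X '' C : Set (MvPolynomial σ K)) := mem_ideal_span_X_image.2 hcon
  refine hs (Ideal.span_le.2 ?_ this)
  rintro _ ⟨v, hv, rfl⟩
  exact X_mem_ker_killVars.2 hv

/-- If `Φ` depends only on the exponents in `C`, then a factor outside the prime generated by the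
variables in `C` can be cancelled from the condition that `Φ ≥ t` on all monomials. -/
theorem le_of_mem_support_of_mul {s f : MvPolynomial σ K} (hs : s ∉ RingHom.ker (killVars K C))
    {Φ : (σ →₀ ℕ) → ℕ} (hΦ : ∀ a b, Φ a + Φ b ≤ Φ (a + b))
    (hC : ∀ a b : σ →₀ ℕ, (∀ v ∈ C, a v = 0) → Φ (a + b) = Φ b)
    [Fintype σ] {t : ℕ} (hsf : ∀ a ∈ (s * f).support, t ≤ Φ a) :
    ∀ a ∈ f.support, t ≤ Φ a := by
  classical
  by_contra! hcon
  obtain ⟨a₀, ha₀, hlt₀⟩ := hcon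
  let δ : (σ →₀ ℕ) → ℕ := fun a ↦ ∑ v, if v ∈ C then a v else 0
  have hδ : ∀ a b, δ (a + b) = δ a + δ b := by
    intro a b
    simp only [δ, ← Finset.sum_add_distrib]
    exact Finset.sum_congr rfl fun v _ ↦ by split_ifs <;> simp
  have hδ0 : ∀ a, δ a = 0 ↔ ∀ v ∈ C, a v = 0 := by
    intro a
    simp [δ, Finset.sum_eq_zero_iff]
  -- A monomial of `s` free of `C` times a monomial of `f` violating the bound, of least degree in
  -- `C`, survives in `s * f` once the pair is chosen with a unique sum.
  let B := f.support.filter fun a ↦ Φ a < t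
  obtain ⟨b, hb, hmin⟩ := B.exists_min_image δ ⟨a₀, Finset.mem_filter.2 ⟨ha₀, hlt₀⟩⟩
  let S₀ := s.support.filter fun a ↦ δ a = 0
  let B₀ := B.filter fun a ↦ δ a = δ b
  obtain ⟨d₀, hd₀, hd₀C⟩ := exists_mem_support_of_notMem_ker_killVars hs
  obtain ⟨d, hd, e, he, huniq⟩ := UniqueSums.uniqueAdd_of_nonempty (A := S₀) (B := B₀)
    ⟨d₀, Finset.mem_filter.2 ⟨hd₀, (hδ0 _).2 hd₀C⟩⟩ ⟨b, Finset.mem_filter.2 ⟨hb, rfl⟩⟩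
  obtain ⟨hds, hdδ⟩ := Finset.mem_filter.1 hd
  obtain ⟨heB, heδ⟩ := Finset.mem_filter.1 he
  obtain ⟨hef, heΦ⟩ := Finset.mem_filter.1 heB
  have hde : Φ (d + e) = Φ e := hC d e ((hδ0 d).1 hdδ)
  have hcoeff : coeff (d + e) (s * f) = coeff d s * coeff e f := by
    rw [coeff_mul]
    refine Finset.sum_eq_single_of_mem (d, e) (by simp) ?_
    rintro ⟨x, y⟩ hxy hne
    rw [Finset.HasAntidiagonal.mem_antidiagonal] at hxy
    dsimp only at hxy ⊢
    by_contra hprod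
    have hx : x ∈ s.support := mem_support_iff.2 (left_ne_zero_of_mul hprod)
    have hy : y ∈ f.support := mem_support_iff.2 (right_ne_zero_of_mul hprod)
    have hyΦ : Φ y < t := by
      have := hΦ x y
      rw [hxy] at this
      omega
    have hyB : y ∈ B := Finset.mem_filter.2 ⟨hy, hyΦ⟩
    have h1 := hmin y hyB
    have h2 : δ x + δ y = δ d + δ e := by rw [← hδ, ← hδ, hxy]
    have hxy' := huniq (Finset.mem_filter.2 ⟨hx, by omega⟩)
      (Finset.mem_filter.2 ⟨hyB, by omega⟩) hxy
    exact hne (Prod.ext hxy'.1 hxy'.2)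
  have := hsf (d + e) (by
    rw [mem_support_iff, hcoeff]
    exact mul_ne_zero (mem_support_iff.1 hds) (mem_support_iff.1 hef))
  omega

end MvPolynomial

end

/-! ### Minimal primes of the edge ideal -/

namespace WeightedOrientedGraph

open MvPolynomial

variable {V K : Type*} [Field K] {D : WeightedOrientedGraph V}

theorem adj_underlying_iff {u v : V} :
    D.underlying.Adj u v ↔ D.toDigraph.Adj u v ∨ D.toDigraph.Adj v u := by
  unfold underlying Digraph.toSimpleGraphInclusive
  rw [SimpleGraph.fromRel_adj, and_iff_right_iff_imp]
  rintro (h | h) rfl <;> exact D.asymm _ _ h h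

theorem edge_mem_edgeIdeal {i j : V} (h : D.toDigraph.Adj i j) :
    (X i * X j ^ D.weight j : MvPolynomial V K) ∈ D.edgeIdeal K :=
  Ideal.subset_span ⟨i, j, h, rfl⟩

theorem isVertexCover_of_edgeIdeal_le {p : Ideal (MvPolynomial V K)} (hp : p.IsPrime)
    (h : D.edgeIdeal K ≤ p) : D.underlying.IsVertexCover {v | X v ∈ p} := by
  have key : ∀ u v, D.toDigraph.Adj u v → (X u : MvPolynomial V K) ∈ p ∨ X v ∈ p :=
    fun u v huv ↦ (hp.mem_or_mem (h (edge_mem_edgeIdeal huv))).imp_right (hp.mem_of_pow_mem _)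
  intro u v huv
  rcases adj_underlying_iff.1 huv with huv | huv
  · exact key u v huv
  · exact (key v u huv).symm

theorem edgeIdeal_le_ker_killVars {C : Set V} (hC : D.underlying.IsVertexCover C) :
    D.edgeIdeal K ≤ RingHom.ker (killVars K C) := by
  refine Ideal.span_le.2 ?_
  rintro _ ⟨i, j, hij, rfl⟩
  rcases hC (adj_underlying_iff.2 (Or.inl hij)) with h | h
  · exact Ideal.mul_mem_right _ _ (X_mem_ker_killVars.2 h)
  · exact Ideal.mul_mem_left _ _
      (Ideal.pow_mem_of_mem _ (X_mem_ker_killVars.2 h) _ (D.weight_pos j))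

theorem ker_killVars_mem_minimalPrimes {C : Set V} (hC : Minimal D.underlying.IsVertexCover C) :
    RingHom.ker (killVars K C) ∈ (D.edgeIdeal K).minimalPrimes := by
  refine ⟨⟨RingHom.ker_isPrime _, edgeIdeal_le_ker_killVars hC.prop⟩, ?_⟩
  rintro q ⟨hq, hIq⟩ hqC
  have hsub : {v | (X v : MvPolynomial V K) ∈ q} ⊆ C := fun v hv ↦ X_mem_ker_killVars.1 (hqC hv)
  exact ker_killVars_le (hC.le_of_le (isVertexCover_of_edgeIdeal_le hq hIq) hsub)

/-- At a minimal prime `p`, each variable of `p` has an edge to a variable that becomes a unit. -/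
theorem exists_adj_notMem {p : Ideal (MvPolynomial V K)} (hp : p ∈ (D.edgeIdeal K).minimalPrimes)
    {v : V} (hv : X v ∈ p) : ∃ u, D.underlying.Adj v u ∧ (X u : MvPolynomial V K) ∉ p := by
  by_contra! hcon
  set C : Set V := {u | (X u : MvPolynomial V K) ∈ p ∧ u ≠ v}
  have hcov := isVertexCover_of_edgeIdeal_le hp.1.1 hp.1.2
  have hC : D.underlying.IsVertexCover C := by
    intro a b hab
    rcases eq_or_ne a v with rfl | ha
    · exact Or.inr ⟨hcon b hab, hab.ne.symm⟩
    rcases eq_or_ne b v with rfl | hb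
    · exact Or.inl ⟨hcon a hab.symm, hab.ne⟩
    exact (hcov hab).imp (fun h ↦ ⟨h, ha⟩) (fun h ↦ ⟨h, hb⟩)
  have hle := hp.2 ⟨RingHom.ker_isPrime (killVars K C), edgeIdeal_le_ker_killVars hC⟩
    (ker_killVars_le fun u hu ↦ hu.1)
  exact (X_mem_ker_killVars.1 (hle hv)).2 rfl

theorem locMem_X_of_adj {p : Ideal (MvPolynomial V K)} (hp : p.IsPrime) {u v : V}
    (h : D.toDigraph.Adj u v) (hv : X v ∉ p) :
    p.LocMem (D.edgeIdeal K) (X u) :=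
  ⟨X v ^ D.weight v, fun h' ↦ hv (hp.mem_of_pow_mem _ h'),
    by rw [mul_comm]; exact edge_mem_edgeIdeal h⟩

theorem locMem_X_pow_weight {p : Ideal (MvPolynomial V K)}
    (hp : p ∈ (D.edgeIdeal K).minimalPrimes) {v : V} (hv : X v ∈ p) :
    p.LocMem (D.edgeIdeal K) (X v ^ D.weight v) := by
  obtain ⟨u, huv, hu⟩ := exists_adj_notMem hp hv
  rcases adj_underlying_iff.1 huv with h | h
  · obtain ⟨n, hn⟩ := Nat.exists_eq_add_of_lt (D.weight_pos v)
    rw [hn, pow_succ]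
    exact (locMem_X_of_adj hp.1.1 h hu).mul_left
  · exact ⟨X u, hu, edge_mem_edgeIdeal h⟩

/-! ### Heavy vertices that are not sinks -/

/-- If `x_v` and `x_z` both lie in `p`, the powers `x_v ^ ω(v)` and `x_z ^ ω(z)` are locally in `I`.
If `x_z ∉ p`, then `x_v` is, and it occurs at least twice; if `x_v ∉ p`, then `x_u` and
`x_z ^ ω(z)` are. -/
theorem locMem_sq_of_path {p : Ideal (MvPolynomial V K)}
    (hp : p ∈ (D.edgeIdeal K).minimalPrimes) {u v z : V} (huv : D.toDigraph.Adj u v)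
    (hvz : D.toDigraph.Adj v z) (hv : 2 ≤ D.weight v) :
    p.LocMem (D.edgeIdeal K ^ 2) (X u * X v ^ D.weight v * X z ^ D.weight z) := by
  have hp' := hp.1.1
  have hcov := isVertexCover_of_edgeIdeal_le hp' hp.1.2
  rw [sq]
  by_cases hvp : X v ∈ p
  · by_cases hzp : X z ∈ p
    · have := ((locMem_X_pow_weight hp hvp).mul hp' (locMem_X_pow_weight hp hzp)).mul_left
        (g := X u)
      rwa [← mul_assoc] at this
    · have hX := locMem_X_of_adj hp' hvz hzp
      obtain ⟨m, hm⟩ := Nat.exists_eq_add_of_le' hv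
      have := (hX.mul hp' hX).mul_left (g := X u * X v ^ m * X z ^ D.weight z)
      rw [hm]
      convert this using 1
      ring
  · have hzp := (hcov (adj_underlying_iff.2 (Or.inl hvz))).resolve_left hvp
    have := ((locMem_X_of_adj hp' huv hvp).mul hp' (locMem_X_pow_weight hp hzp)).mul_left
      (g := X v ^ D.weight v)
    convert this using 1
    ring

/-- On a path `u → v → z` with `v` heavy, `x_u x_v ^ ω(v) x_z ^ ω(z)` times a power of the edge `uv`
separates the two powers. -/
theorem isSink_of_pow_eq_idealSymbolicPower
    (hsource : ∀ v, D.IsSource v → D.weight v = 1) {t : ℕ} (ht : 2 ≤ t)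
    (h : D.edgeIdeal K ^ t = idealSymbolicPower (D.edgeIdeal K) t) {v : V}
    (hv : v ∈ D.heavyVertices) : D.IsSink v := by
  classical
  intro z hvz
  replace hv : 2 ≤ D.weight v := hv
  obtain ⟨u, huv⟩ : ∃ u, D.toDigraph.Adj u v := by
    by_contra! hcon
    have := hsource v ⟨⟨z, hvz⟩, hcon⟩
    omega
  have hirr : ∀ x, ¬ D.toDigraph.Adj x x := fun x hx ↦ D.asymm x x hx hx
  have hne_uv : u ≠ v := by rintro rfl; exact hirr _ huv
  have hne_vz : v ≠ z := by rintro rfl; exact hirr _ hvz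
  have hne_uz : u ≠ z := by rintro rfl; exact D.asymm _ _ huv hvz
  obtain ⟨n, rfl⟩ := Nat.exists_eq_add_of_le' ht
  have hmem : (X u * X v ^ D.weight v * X z ^ D.weight z *
      (X u * X v ^ D.weight v) ^ n : MvPolynomial V K) ∈ D.edgeIdeal K ^ (n + 2) := by
    rw [h, mem_idealSymbolicPower_iff]
    intro p hp
    have hp' := hp.1.1
    change p.LocMem _ _
    rw [add_comm, pow_add]
    exact Ideal.LocMem.mul hp' (locMem_sq_of_path hp huv hvz hv)
      (.of_mem hp' (Ideal.pow_mem_pow (edge_mem_edgeIdeal huv) n))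
  obtain ⟨k, hk⟩ := Nat.exists_eq_add_of_lt (D.weight_pos z)
  rw [zero_add] at hk
  set w := D.weight v
  -- With `ω(z) = k + 1`, these weights give both edges of the path weight exactly `N`, an edge
  -- joining `u` and `z` in either direction weight at least `N`, and `x_z ^ ω(z)` weight less
  -- than `N`.
  let N := (k + 1) + w * (k + 1) ^ 2
  let l : V → ℕ := fun x ↦
    if x = u then (k + 1) + w * (k + 1) * k else if x = v then k + 1 else
      if x = z then w * (k + 1) else N
  have hlu : l u = (k + 1) + w * (k + 1) * k := by simp [l]
  have hlv : l v = k + 1 := by simp [l, hne_uv.symm]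
  have hlz : l z = w * (k + 1) := by simp [l, hne_uz.symm, hne_vz.symm]
  have hl : ∀ x, x ≠ u → x ≠ v → x ≠ z → l x = N := by
    intro x h1 h2 h3
    simp [l, h1, h2, h3]
  let Φ : (V →₀ ℕ) → ℕ := fun a ↦ Finsupp.weight l a
  have hΦadd : ∀ a b, Φ (a + b) = Φ a + Φ b := fun a b ↦ map_add _ a b
  have hΦsingle : ∀ x m, Φ (Finsupp.single x m) = m * l x := by
    intro x m
    simp [Φ, Finsupp.weight_apply]
  obtain ⟨a, ha⟩ : ∃ a, a = Finsupp.single u (n + 1) + Finsupp.single v (w * (n + 1)) +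
      Finsupp.single z (k + 1) := ⟨_, rfl⟩
  have hmono : (X u * X v ^ w * X z ^ D.weight z * (X u * X v ^ w) ^ n : MvPolynomial V K) =
      monomial a 1 := by
    have hadd : ∀ a b : V →₀ ℕ, monomial (a + b) (1 : K) = monomial a 1 * monomial b 1 := by
      simp [monomial_mul]
    rw [ha, hadd, hadd, ← X_pow_eq_monomial, ← X_pow_eq_monomial, ← X_pow_eq_monomial, hk]
    ring
  rw [hmono] at hmem
  have hle := le_of_mem_support_of_mem_span_pow (Φ := Φ) (fun a b ↦ (hΦadd a b).ge) (N := N) (by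
    rintro _ ⟨i, j, hij, rfl⟩ a ha
    rw [X_pow_eq_monomial, X, monomial_mul] at ha
    rw [Finset.mem_singleton.1 (support_monomial_subset ha), hΦadd, hΦsingle, hΦsingle, one_mul]
    have hwj := D.weight_pos j
    have hjl : l j ≤ D.weight j * l j := Nat.le_mul_of_pos_left _ hwj
    by_cases hi : i ≠ u ∧ i ≠ v ∧ i ≠ z
    · rw [hl i hi.1 hi.2.1 hi.2.2]; omega
    by_cases hj : j ≠ u ∧ j ≠ v ∧ j ≠ z
    · rw [hl j hj.1 hj.2.1 hj.2.2] at hjl ⊢; omega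
    have hi' : i = u ∨ i = v ∨ i = z := by tauto
    have hj' : j = u ∨ j = v ∨ j = z := by tauto
    rcases hi' with rfl | rfl | rfl <;> rcases hj' with rfl | rfl | rfl
    · exact absurd hij (hirr _)
    · rw [hlu, hlv]; apply le_of_eq; simp only [N, w]; ring
    · rw [hlu, hlz, hk]; simp only [N]; nlinarith [Nat.zero_le (w * (k + 1) * k)]
    · exact absurd hij (D.asymm _ _ huv)
    · exact absurd hij (hirr _)
    · rw [hlv, hlz, hk]; apply le_of_eq; simp only [N]; ring
    · rw [hlz]; rw [hlu] at hjl ⊢; simp only [N]; nlinarith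
    · exact absurd hij (D.asymm _ _ hvz)
    · exact absurd hij (hirr _)) (n + 2) hmem a (by simp)
  rw [ha, hΦadd, hΦadd, hΦsingle, hΦsingle, hΦsingle, hlu, hlv, hlz] at hle
  simp only [N] at hle
  nlinarith

/-! ### Levels of monomials and odd closed walks -/

/-- The level `∑ v ∈ C, ⌊a v / ω v⌋` of the exponent `a` along `C`; the division is that of natural
numbers. -/
def level (D : WeightedOrientedGraph V) (C : Finset V) (a : V →₀ ℕ) : ℕ :=
  ∑ v ∈ C, a v / D.weight v

theorem level_add_le (C : Finset V) (a b : V →₀ ℕ) :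
    D.level C a + D.level C b ≤ D.level C (a + b) := by
  rw [level, level, ← Finset.sum_add_distrib]
  exact Finset.sum_le_sum fun v _ ↦ Nat.div_add_div_le_add_div

theorem level_single_weight_add [DecidableEq V] (C : Finset V) (v : V) (a : V →₀ ℕ) :
    D.level C (Finsupp.single v (D.weight v) + a) = (if v ∈ C then 1 else 0) + D.level C a := by
  have key : ∀ x, (Finsupp.single v (D.weight v) + a) x / D.weight x =
      (if v = x then 1 else 0) + a x / D.weight x := by
    intro x
    by_cases hx : v = x
    · subst hx
      simp [Nat.add_div_left _ (D.weight_pos v), add_comm]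
    · simp [hx]
  simp only [level, key, Finset.sum_add_distrib, Finset.sum_ite_eq]

theorem weight_eq_one_of_adj (hsink : ∀ v ∈ D.heavyVertices, D.IsSink v) {i j : V}
    (h : D.toDigraph.Adj i j) : D.weight i = 1 := by
  by_contra hne
  have := D.weight_pos i
  exact hsink i (show 2 ≤ D.weight i by omega) j h

theorem X_pow_weight_mul_mem (hsink : ∀ v ∈ D.heavyVertices, D.IsSink v) {u v : V}
    (h : D.underlying.Adj u v) :
    (X u ^ D.weight u * X v ^ D.weight v : MvPolynomial V K) ∈ D.edgeIdeal K := by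
  rcases adj_underlying_iff.1 h with h | h
  · rw [weight_eq_one_of_adj hsink h, pow_one]
    exact edge_mem_edgeIdeal h
  · rw [weight_eq_one_of_adj hsink h, pow_one, mul_comm]
    exact edge_mem_edgeIdeal h

theorem level_edge [DecidableEq V] (hsink : ∀ v ∈ D.heavyVertices, D.IsSink v) (C : Finset V)
    {i j : V} (h : D.toDigraph.Adj i j) {a : V →₀ ℕ}
    (ha : a ∈ (X i * X j ^ D.weight j : MvPolynomial V K).support) :
    D.level C a = (if i ∈ C then 1 else 0) + (if j ∈ C then 1 else 0) := by
  rw [X_pow_eq_monomial, X, monomial_mul] at ha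
  have hi : Finsupp.single i 1 = Finsupp.single i (D.weight i) := by
    rw [weight_eq_one_of_adj hsink h]
  rw [Finset.mem_singleton.1 (support_monomial_subset ha), hi, level_single_weight_add,
    ← add_zero (Finsupp.single j _), level_single_weight_add]
  simp [level]

theorem exists_prod_X_pow_weight_eq_monomial [Fintype V] (L : List V) :
    ∃ a : V →₀ ℕ, (L.map fun v ↦ (X v ^ D.weight v : MvPolynomial V K)).prod = monomial a 1 ∧
      D.level Finset.univ a = L.length := by
  classical
  induction L with
  | nil => exact ⟨0, by simp, by simp [level]⟩
  | cons v L ih =>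
    obtain ⟨a, ha, hlev⟩ := ih
    refine ⟨Finsupp.single v (D.weight v) + a, ?_, ?_⟩
    · rw [List.map_cons, List.prod_cons, ha, X_pow_eq_monomial, monomial_mul, one_mul]
    · rw [level_single_weight_add, hlev]
      simp [add_comm]

/-- The separating monomial is the product of the `x_v ^ ω(v)` over the vertices of the closed walk
and of `t - s` copies of an edge: locally it is a product of `t` elements of `I`, but its level is
`2 * t - 1`. -/
theorem lt_of_odd_closed_walk [Finite V] (hsink : ∀ v ∈ D.heavyVertices, D.IsSink v) {t : ℕ}
    (h : D.edgeIdeal K ^ t = idealSymbolicPower (D.edgeIdeal K) t) {x : V}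
    (c : D.underlying.Walk x x) {s : ℕ} (hs : 1 ≤ s) (hc : c.length = 2 * s - 1) : t < s := by
  classical
  by_contra! hst
  have := Fintype.ofFinite V
  obtain ⟨i, j, hij⟩ : ∃ i j, D.toDigraph.Adj i j := by
    cases c with
    | nil => rw [SimpleGraph.Walk.length_nil] at hc; omega
    | cons hadj _ =>
      rcases adj_underlying_iff.1 hadj with h | h
      exacts [⟨_, _, h⟩, ⟨_, _, h⟩]
  let Y : V → MvPolynomial V K := fun v ↦ X v ^ D.weight v
  -- The tail of the support lists the visits of the closed walk, its two end points counted once.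
  let L : List V := c.support.tail ++ (List.replicate (t - s) i ++ List.replicate (t - s) j)
  have hL : (L.map Y).prod = (c.support.tail.map Y).prod * (Y i * Y j) ^ (t - s) := by
    simp [L, mul_pow]
  have hmem : (L.map Y).prod ∈ D.edgeIdeal K ^ t := by
    rw [h, mem_idealSymbolicPower_iff]
    intro p hp
    have hp' := hp.1.1
    have hcov := isVertexCover_of_edgeIdeal_le hp' hp.1.2
    change p.LocMem _ _
    rw [hL, ← Nat.add_sub_cancel' hst, pow_add, Nat.add_sub_cancel_left]
    have hcount := hcov.length_le c
    refine Ideal.LocMem.mul hp' (.mono (Ideal.pow_le_pow_right ?_)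
      (.list_prod_map hp' (· ∈ {v | (X v : MvPolynomial V K) ∈ p}) Y
        (fun v hv ↦ locMem_X_pow_weight hp hv) _))
      (.of_mem hp' (Ideal.pow_mem_pow
        (X_pow_weight_mul_mem hsink (adj_underlying_iff.2 (Or.inl hij))) _))
    omega
  obtain ⟨a, ha, hlev⟩ := exists_prod_X_pow_weight_eq_monomial (D := D) (K := K) L
  rw [show (L.map Y).prod = _ from ha] at hmem
  have hle := le_of_mem_support_of_mem_span_pow (level_add_le (D := D) Finset.univ) (N := 2) (by
    rintro _ ⟨i, j, hij, rfl⟩ a ha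
    rw [level_edge hsink _ hij ha]
    simp) t hmem a (by simp)
  have hlen : L.length = (2 * s - 1) + ((t - s) + (t - s)) := by
    simp [L, hc]
  omega

/-! ### The symbolic power of the edge ideal when heavy vertices are sinks -/

theorem le_level_of_mem_idealSymbolicPower [Finite V]
    (hsink : ∀ v ∈ D.heavyVertices, D.IsSink v) {t : ℕ} {f : MvPolynomial V K}
    (hf : f ∈ idealSymbolicPower (D.edgeIdeal K) t) {a : V →₀ ℕ} (ha : a ∈ f.support)
    {C : Finset V} (hC : D.underlying.IsVertexCover C) : t ≤ D.level C a := by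
  classical
  have := Fintype.ofFinite V
  -- Only minimal covers give minimal primes, and the level can only grow with the cover.
  obtain ⟨C', hC'C, hC'⟩ := exists_minimal_le_of_wellFoundedLT D.underlying.IsVertexCover _ hC
  obtain ⟨s, hs, hsf⟩ := mem_idealSymbolicPower_iff.1 hf _ (ker_killVars_mem_minimalPrimes hC')
  refine le_trans ?_ (Finset.sum_le_sum_of_subset (s := C'.toFinset)
    (fun v hv ↦ hC'C (Set.mem_toFinset.1 hv)))
  refine le_of_mem_support_of_mul hs (level_add_le (D := D) C'.toFinset) ?_ ?_ a ha
  · intro d e hd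
    refine Finset.sum_congr rfl fun v hv ↦ ?_
    simp [hd v (Set.mem_toFinset.1 hv)]
  · intro d hd
    have hle := le_of_mem_support_of_mem_span_pow (level_add_le (D := D) C'.toFinset) (N := 1) (by
      rintro _ ⟨i, j, hij, rfl⟩ a ha
      rw [level_edge hsink _ hij ha]
      rcases hC'.prop (adj_underlying_iff.2 (Or.inl hij)) with h | h <;> simp [h]) t hsf d hd
    omega

theorem monomial_mem_edgeIdeal_pow [Fintype V] (hsink : ∀ v ∈ D.heavyVertices, D.IsSink v)
    {t : ℕ} {a : V →₀ ℕ} {g h : Fin t → Σ v, Fin (a v / D.weight v)}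
    (hinj : (Sum.elim g h).Injective) (hadj : ∀ i, D.underlying.Adj (g i).1 (h i).1) :
    (monomial a 1 : MvPolynomial V K) ∈ D.edgeIdeal K ^ t := by
  classical
  let Y : (Σ v, Fin (a v / D.weight v)) → MvPolynomial V K := fun x ↦ X x.1 ^ D.weight x.1
  have hprod : ∏ i, Y (g i) * Y (h i) ∈ D.edgeIdeal K ^ t := by
    have := Ideal.prod_mem_prod (s := Finset.univ) (I := fun _ : Fin t ↦ D.edgeIdeal K)
      (x := fun i ↦ Y (g i) * Y (h i)) fun i _ ↦ X_pow_weight_mul_mem hsink (hadj i)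
    simpa using this
  refine Ideal.mem_of_dvd _ ?_ hprod
  have h1 : ∏ i, Y (g i) * Y (h i) ∣ ∏ x, Y x := by
    have : ∏ i, Y (g i) * Y (h i) = ∏ x ∈ Finset.univ.image (Sum.elim g h), Y x := by
      rw [Finset.prod_image fun x _ y _ hxy ↦ hinj hxy, Fintype.prod_sum_type,
        Finset.prod_mul_distrib]
      rfl
    rw [this]
    exact Finset.prod_dvd_prod_of_subset _ _ _ (Finset.subset_univ _)
  refine h1.trans ?_
  rw [Fintype.prod_sigma, monomial_eq, C_1, one_mul, Finsupp.prod_fintype _ _ (by simp)]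
  refine Finset.prod_dvd_prod_of_dvd _ _ fun v _ ↦ ?_
  simp only [Y, Finset.prod_const, Finset.card_univ, Fintype.card_fin, ← pow_mul]
  exact pow_dvd_pow _ (Nat.mul_div_le _ _)

theorem idealSymbolicPower_le_pow [Finite V] (hsink : ∀ v ∈ D.heavyVertices, D.IsSink v) {t : ℕ}
    (hodd : ∀ s, 2 ≤ s → s ≤ t → ¬ D.underlying.ContainsCycleOfLength (2 * s - 1)) :
    idealSymbolicPower (D.edgeIdeal K) t ≤ D.edgeIdeal K ^ t := by
  have := Fintype.ofFinite V
  intro f hf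
  rw [f.as_sum]
  refine Ideal.sum_mem _ fun a ha ↦ ?_
  rw [← mul_one (coeff a f), ← C_mul_monomial]
  refine Ideal.mul_mem_left _ _ ?_
  obtain ⟨g, h, hinj, hadj⟩ := SimpleGraph.exists_blowUp_matching (G := D.underlying)
    (fun v ↦ a v / D.weight v) t
    (fun C hC ↦ le_level_of_mem_idealSymbolicPower hsink hf ha hC) (by
      intro x c hc ho
      by_contra! hlt
      obtain ⟨k, hk⟩ := ho
      have := hc.three_le_length
      exact hodd (k + 1) (by omega) (by omega) ⟨x, c, hc, by omega⟩)
  exact monomial_mem_edgeIdeal_pow hsink hinj hadj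

end WeightedOrientedGraph

theorem theorem4p5 {V : Type*} [Finite V] (K : Type*) [Field K] (D : WeightedOrientedGraph V)
    (hsource : ∀ v, D.IsSource v → D.weight v = 1) (t : ℕ) (ht : 2 ≤ t) :
    D.edgeIdeal K ^ t = idealSymbolicPower (D.edgeIdeal K) t ↔
      (∀ v ∈ D.heavyVertices, D.IsSink v) ∧
        ∀ s : ℕ, 2 ≤ s → s ≤ t → ¬ D.underlying.ContainsCycleOfLength (2 * s - 1) := by
  constructor
  · intro h
    have hsink : ∀ v ∈ D.heavyVertices, D.IsSink v := fun v hv ↦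
      D.isSink_of_pow_eq_idealSymbolicPower hsource ht h hv
    refine ⟨hsink, ?_⟩
    rintro s hs hst ⟨x, c, -, hlen⟩
    exact (D.lt_of_odd_closed_walk hsink h c (by omega) hlen).not_ge hst
  · rintro ⟨hsink, hodd⟩
    exact le_antisymm (pow_le_idealSymbolicPower _ _) (D.idealSymbolicPower_le_pow hsink hodd)
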